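/- Let $K\ge 1$, $[K]=\{1,\dots,K\}$, $\Delta=\{\theta\in\mathbb R^K:\theta_k\ge 0,\ \sum_k\theta_k=1\}$, $\epsilon>0$, $\kappa\in(0,1)$, $\epsilon_1=\kappa\epsilon$. *Mechanism.* For $\Omega\subseteq[K]$, $x\in\Omega$, let $\mathrm{SRR}(x;\Omega,e)$ output $x$ with probability $e^{e}/(e^{e}+|\Omega|-1)$ and otherwise a uniform element of $\Omega\setminus\{x\}$. For $S\subsetneq[K]$ let $\epsilon_2=\min\{\epsilon,\ln\frac{|S^c|-1}{e^{\epsilon_1-\epsilon}|S^c|-1}\}$ if $\epsilon-\epsilon_1<\ln|S^c|$ and $S\neq\emptyset$, and $\epsilon_2=\epsilon$ otherwise. $\mathrm{RRRR}(x;S,\epsilon)$ draws $R$ uniformly from $S^c$ and outputs $\mathrm{SRR}(x;S\cup\{R\},\epsilon_1)$ if $x\in S$; if $x\notin S$ it draws $R=\mathrm{SRR}(x;S^c,\epsilon_2)$ and outputs $\mathrm{SRR}(R;S\cup\{R\},\epsilon_1)$. Let $g_{S,\epsilon}(y|x)$ be the probability that it outputs $y$ on input $x$, and $h_{S,\epsilon}(y|\theta)=\sum_x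 g_{S,\epsilon}(y|x)\theta_x$. *Subset selection.* Let $U(\theta,S,\epsilon)\in\mathbb R$ be a utility function. For $\theta\in\Delta$ let $\sigma_\theta$ be a permutation of $[K]$ with $\theta_{\sigma_\theta(1)}\ge\dots\ge\theta_{\sigma_\theta(K)}$, $S_{k,\theta}=\{\sigma_\theta(1),\dots,\sigma_\theta(k)\}$, $k^*_\theta\in\arg\max_{0\le k\le K-1}U(\theta,S_{k,\theta},\epsilon)$ and $S^*_\theta=S_{k^*_\theta,\theta}$, with ties broken by any fixed rule for which $\theta\mapsto S^*_\theta$ is measurable. *Algorithm with exact posterior sampling.* Let $\eta$ be a probability density on $\Delta$ with respect to Lebesgue measure $d\theta$ in the first $K-1$ coordinates, and $$\Pi(A\mid y_{1:n},s_{1:n})=\frac{\int_A\eta(\theta)\prod_{t=1}^n h_{s_t,\epsilon}(y_t|\theta)\,d\theta}{\int_\Delta\eta(\theta)\prod_{t=1}^n h_{s_t,\epsilon}(y_t|\theta)\,d\theta}.$$ Fix $\theta^*,\theta_{\rm init}\in\Delta$. Start with $\Theta_0=\theta_{\rm init}$; for $t=1,2,\dots$ set $S_t=S^*_{\Theta_{t-1}}$,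 draw $Y_t$ from $h_{S_t,\epsilon}(\cdot|\theta^*)$ and then $\Theta_t$ from $\Pi(\cdot\mid Y_{1:t},S_{1:t})$. Let $P_{\theta^*}$ be the resulting law, $E_{\theta^*}$ its expectation, and $S^*=S^*_{\theta^*}$. **Theorem.** Assume: 1. there are $d,B>0$ such that $\eta(\theta')>0$ and $\eta(\theta)/\eta(\theta')<B$ for all $\theta,\theta'\in\Delta$ with $\|\theta'-\theta^*\|_2<d$; 2. $\theta^*_{\sigma_{\theta^*}(1)}>\dots>\theta^*_{\sigma_{\theta^*}(K)}$; 3. for every $S\subsetneq[K]$, $\theta\mapsto U(\theta,S,\epsilon)$ is continuous on $\Delta$; 4. the maximizer of $k\mapsto U(\theta^*,S_{k,\theta^*},\epsilon)$ over $\{0,\dots,K-1\}$ is unique. Then $$\lim_{n\to\infty}P_{\theta^*}(S_n=S^*)=1,\qquad\text{and consequently}\qquad \lim_{n\to\infty}\frac1n\sum_{t=1}^n E_{\theta^*}\big[\mathbb I(S_t=S^*)\big]=1 .$$ -/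

import Mathlib

open MeasureTheory ProbabilityTheory Filter Topology
open scoped ENNReal

noncomputable section

namespace AdOBEst

/-- The probability simplex of probability vectors on `K` categories. -/
abbrev Simplex (K : ℕ) : Type := stdSimplex ℝ (Fin K)

/-- Probability that the standard randomized response on the set `Ω` with parameter `e` and input
`x ∈ Ω` outputs `y`: the input is reported with probability `exp e / (exp e + |Ω| - 1)`, otherwise
the output is uniform on `Ω \ {x}`. -/
def srr {K : ℕ} (Ω : Finset (Fin K)) (e : ℝ) (x y : Fin K) : ℝ :=
  let p := Real.exp e / (Real.exp e + (Ω.card : ℝ) - 1)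
  if y = x then p else if y ∈ Ω then (1 - p) * (1 / ((Ω.card : ℝ) - 1)) else 0

/-- The second privacy parameter of the mechanism, as a function of `ε`, `ε₁` and the subset. -/
def eps2 {K : ℕ} (ε ε₁ : ℝ) (S : Finset (Fin K)) : ℝ :=
  if ε - ε₁ < Real.log (Sᶜ.card : ℝ) ∧ 0 < S.card then
    min ε (Real.log (((Sᶜ.card : ℝ) - 1) / (Real.exp (ε₁ - ε) * (Sᶜ.card : ℝ) - 1)))
  else ε

/-- Probability `g_{S,ε}(y | x)` that the randomly restricted randomized response with subset `S`,
`ε₁ = κ ε` and `ε₂ = eps2 ε ε₁ S` outputs `y` on input `x`: an element `r` of `Sᶜ` is drawn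
(uniformly if `x ∈ S`, by a randomized response of `x` on `Sᶜ` otherwise), and then `x`
(respectively `r`) goes through a randomized response on `S ∪ {r}`. -/
def rrrr {K : ℕ} (ε κ : ℝ) (S : Finset (Fin K)) (y x : Fin K) : ℝ :=
  if x ∈ S then ∑ r ∈ Sᶜ, (1 / (Sᶜ.card : ℝ)) * srr (insert r S) (κ * ε) x y
  else ∑ r ∈ Sᶜ, srr Sᶜ (eps2 ε (κ * ε) S) x r * srr (insert r S) (κ * ε) r y

/-- Marginal probability `h_{S,ε}(y | θ)` of the response `y` when the input has law `θ`. -/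
def marginal {K : ℕ} (ε κ : ℝ) (S : Finset (Fin K)) (y : Fin K) (θ : Simplex K) : ℝ :=
  ∑ x, rrrr ε κ S y x * θ x

/-- The first `K - 1` coordinates of a probability vector. -/
def freeCoords {K : ℕ} (θ : Simplex K) : Fin (K - 1) → ℝ :=
  fun i => θ (Fin.castLE (Nat.sub_le K 1) i)

/-- The measure `dθ` on the simplex: Lebesgue measure in the first `K - 1` coordinates. -/
def simplexVolume (K : ℕ) : Measure (Simplex K) :=
  (volume : Measure (Fin (K - 1) → ℝ)).comap freeCoords

/-- A prior given by a probability density with respect to `dθ`. -/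
structure Prior (K : ℕ) where
  density : Simplex K → ℝ
  measurable_density : Measurable density
  density_nonneg : ∀ θ, 0 ≤ density θ
  lintegral_density : ∫⁻ θ, ENNReal.ofReal (density θ) ∂(simplexVolume K) = 1

/-- Prior times likelihood of the responses `y` obtained with the subsets `s`, as a measure. -/
def posteriorWeight {K : ℕ} (ε κ : ℝ) (η : Prior K) {ι : Type} [Fintype ι]
    (s : ι → Finset (Fin K)) (y : ι → Fin K) : Measure (Simplex K) :=
  (simplexVolume K).withDensity
    fun θ => ENNReal.ofReal (η.density θ * ∏ i, marginal ε κ (s i) (y i) θ)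

/-- The posterior distribution given the responses `y` obtained with the subsets `s`. -/
def posterior {K : ℕ} (ε κ : ℝ) (η : Prior K) {ι : Type} [Fintype ι]
    (s : ι → Finset (Fin K)) (y : ι → Fin K) : Measure (Simplex K) :=
  (posteriorWeight ε κ η s y Set.univ)⁻¹ • posteriorWeight ε κ η s y

/-- The set `{σ(1), …, σ(k)}` of the first `k` categories in the order `σ`. -/
def topSet {K : ℕ} (σ : Equiv.Perm (Fin K)) (k : Fin K) : Finset (Fin K) :=
  (Finset.univ.filter fun i => i < k).image σ

/-- A rule `θ ↦ S*_θ` that selects the best subset for the utility `U`: `σ θ` sorts the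
components of `θ` in non-increasing order and `k θ ∈ {0, …, K-1}` maximizes
`k ↦ U(θ, {σ_θ(1), …, σ_θ(k)}, ε)`. Ties may be broken in any (measurable) way. -/
structure SelectionRule {K : ℕ} (U : Simplex K → Finset (Fin K) → ℝ → ℝ) (ε : ℝ) where
  σ : Simplex K → Equiv.Perm (Fin K)
  k : Simplex K → Fin K
  sorted : ∀ θ : Simplex K, Antitone fun i => θ (σ θ i)
  maximal : ∀ (θ : Simplex K) (j : Fin K), U θ (topSet (σ θ) j) ε ≤ U θ (topSet (σ θ) (k θ)) ε
  measurable_topSet : Measurable fun θ => topSet (σ θ) (k θ)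

/-- The best subset `S*_θ`. -/
def SelectionRule.best {K : ℕ} {U : Simplex K → Finset (Fin K) → ℝ → ℝ} {ε : ℝ}
    (R : SelectionRule U ε) (θ : Simplex K) : Finset (Fin K) :=
  topSet (R.σ θ) (R.k θ)

/-! ### Facts that make the transition probabilities below well defined -/

lemma topSet_ne_univ {K : ℕ} (σ : Equiv.Perm (Fin K)) (k : Fin K) :
    topSet σ k ≠ Finset.univ := by
  intro h
  have : σ k ∈ topSet σ k := by rw [h]; exact Finset.mem_univ _
  simp [topSet] at this

lemma srr_denom_pos {K : ℕ} {Ω : Finset (Fin K)} {x : Fin K} (hx : x ∈ Ω) (e : ℝ) :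
    0 < Real.exp e + (Ω.card : ℝ) - 1 := by
  have h1 : (1 : ℝ) ≤ Ω.card := by exact_mod_cast Finset.card_pos.mpr ⟨x, hx⟩
  have := Real.exp_pos e
  linarith

lemma srr_pos {K : ℕ} {Ω : Finset (Fin K)} {x y : Fin K} (hx : x ∈ Ω) (hy : y ∈ Ω) (e : ℝ) :
    0 < srr Ω e x y := by
  have hd := srr_denom_pos hx e
  unfold srr
  by_cases hxy : y = x
  · simp only [hxy, if_true]
    exact div_pos (Real.exp_pos e) hd
  · simp only [hxy, if_false, hy, if_true]
    have h2 : (1 : ℝ) < Ω.card := by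
      exact_mod_cast Finset.one_lt_card.mpr ⟨y, hy, x, hx, hxy⟩
    apply mul_pos
    · rw [sub_pos, div_lt_one hd]; linarith
    · exact one_div_pos.mpr (by linarith)

lemma srr_nonneg {K : ℕ} {Ω : Finset (Fin K)} {x : Fin K} (hx : x ∈ Ω) (y : Fin K) (e : ℝ) :
    0 ≤ srr Ω e x y := by
  by_cases hy : y ∈ Ω
  · exact (srr_pos hx hy e).le
  · have hxy : y ≠ x := fun h => hy (h ▸ hx)
    simp [srr, hxy, hy]

lemma srr_eq_zero {K : ℕ} {Ω : Finset (Fin K)} {x y : Fin K} (hx : x ∈ Ω) (hy : y ∉ Ω) (e : ℝ) :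
    srr Ω e x y = 0 := by
  have hxy : y ≠ x := fun h => hy (h ▸ hx)
  simp [srr, hxy, hy]

lemma srr_sum {K : ℕ} {Ω : Finset (Fin K)} {x : Fin K} (hx : x ∈ Ω) (e : ℝ) :
    ∑ y ∈ Ω, srr Ω e x y = 1 := by
  have hd := srr_denom_pos hx e
  rw [← Finset.add_sum_erase _ _ hx]
  have h1 : ∀ y ∈ Ω.erase x, srr Ω e x y =
      (1 - Real.exp e / (Real.exp e + (Ω.card : ℝ) - 1)) * (1 / ((Ω.card : ℝ) - 1)) := by
    intro y hy
    rw [Finset.mem_erase] at hy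
    simp [srr, hy.1, hy.2]
  rw [Finset.sum_congr rfl h1, Finset.sum_const, Finset.card_erase_of_mem hx, nsmul_eq_mul,
    Nat.cast_sub (Finset.card_pos.mpr ⟨x, hx⟩), Nat.cast_one]
  have h2 : srr Ω e x x = Real.exp e / (Real.exp e + (Ω.card : ℝ) - 1) := by simp [srr]
  rw [h2]
  by_cases hc : (Ω.card : ℝ) - 1 = 0
  · have : Real.exp e + (Ω.card : ℝ) - 1 = Real.exp e := by linarith
    rw [hc, this, div_self (Real.exp_pos e).ne']
    simp
  · field_simp
    ring

lemma srr_sum_univ {K : ℕ} {Ω : Finset (Fin K)} {x : Fin K} (hx : x ∈ Ω) (e : ℝ) :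
    ∑ y, srr Ω e x y = 1 := by
  rw [← srr_sum hx e]
  exact (Finset.sum_subset (Finset.subset_univ Ω) fun y _ hy => srr_eq_zero hx hy e).symm

lemma compl_nonempty {K : ℕ} {S : Finset (Fin K)} (hS : S ≠ Finset.univ) : Sᶜ.Nonempty := by
  rw [Finset.nonempty_iff_ne_empty, ne_eq, Finset.compl_eq_empty_iff]
  exact hS

lemma rrrr_pos {K : ℕ} (ε κ : ℝ) {S : Finset (Fin K)} (hS : S ≠ Finset.univ) (y x : Fin K) :
    0 < rrrr ε κ S y x := by
  have hne := compl_nonempty hS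
  have hc : (0 : ℝ) < 1 / (Sᶜ.card : ℝ) := by
    apply one_div_pos.mpr; exact_mod_cast hne.card_pos
  obtain ⟨r₀, hr₀, hy⟩ : ∃ r ∈ Sᶜ, y ∈ insert r S := by
    by_cases hy : y ∈ S
    · exact ⟨hne.choose, hne.choose_spec, Finset.mem_insert_of_mem hy⟩
    · exact ⟨y, Finset.mem_compl.mpr hy, Finset.mem_insert_self _ _⟩
  unfold rrrr
  split_ifs with hx
  · apply Finset.sum_pos'
    · intro r _
      exact mul_nonneg hc.le (srr_nonneg (Finset.mem_insert_of_mem hx) _ _)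
    · exact ⟨r₀, hr₀, mul_pos hc (srr_pos (Finset.mem_insert_of_mem hx) hy _)⟩
  · have hx' := Finset.mem_compl.mpr hx
    apply Finset.sum_pos'
    · intro r _
      exact mul_nonneg (srr_nonneg hx' _ _) (srr_nonneg (Finset.mem_insert_self _ _) _ _)
    · exact ⟨r₀, hr₀, mul_pos (srr_pos hx' hr₀ _) (srr_pos (Finset.mem_insert_self _ _) hy _)⟩

lemma rrrr_sum {K : ℕ} (ε κ : ℝ) {S : Finset (Fin K)} (hS : S ≠ Finset.univ) (x : Fin K) :
    ∑ y, rrrr ε κ S y x = 1 := by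
  have hne := compl_nonempty hS
  have hc : (Sᶜ.card : ℝ) ≠ 0 := by exact_mod_cast hne.card_pos.ne'
  unfold rrrr
  split_ifs with hx
  · rw [Finset.sum_comm]
    simp_rw [← Finset.mul_sum, srr_sum_univ (Finset.mem_insert_of_mem hx)]
    rw [Finset.sum_const, nsmul_eq_mul, mul_one, one_div_mul_cancel hc]
  · rw [Finset.sum_comm]
    simp_rw [← Finset.mul_sum, srr_sum_univ (Finset.mem_insert_self _ _), mul_one]
    exact srr_sum (Finset.mem_compl.mpr hx) _

lemma simplex_sum {K : ℕ} (θ : Simplex K) : ∑ x, θ x = 1 := θ.2.2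

lemma simplex_nonneg {K : ℕ} (θ : Simplex K) (x : Fin K) : 0 ≤ θ x := θ.2.1 x

lemma marginal_pos {K : ℕ} (ε κ : ℝ) {S : Finset (Fin K)} (hS : S ≠ Finset.univ) (y : Fin K)
    (θ : Simplex K) : 0 < marginal ε κ S y θ := by
  have hsum := simplex_sum θ
  obtain ⟨x, hx⟩ : ∃ x, θ x ≠ 0 := by
    by_contra! h
    simp [h] at hsum
  apply Finset.sum_pos'
  · intro z _
    exact mul_nonneg (rrrr_pos ε κ hS y z).le (simplex_nonneg θ z)
  · exact ⟨x, Finset.mem_univ _,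
      mul_pos (rrrr_pos ε κ hS y x) (lt_of_le_of_ne (simplex_nonneg θ x) hx.symm)⟩

lemma marginal_sum {K : ℕ} (ε κ : ℝ) {S : Finset (Fin K)} (hS : S ≠ Finset.univ)
    (θ : Simplex K) : ∑ y, marginal ε κ S y θ = 1 := by
  unfold marginal
  rw [Finset.sum_comm]
  simp_rw [← Finset.sum_mul, rrrr_sum ε κ hS, one_mul]
  exact simplex_sum θ

lemma marginal_le_one {K : ℕ} (ε κ : ℝ) {S : Finset (Fin K)} (hS : S ≠ Finset.univ) (y : Fin K)
    (θ : Simplex K) : marginal ε κ S y θ ≤ 1 := by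
  rw [← marginal_sum ε κ hS θ]
  exact Finset.single_le_sum (f := fun y => marginal ε κ S y θ)
    (fun z _ => (marginal_pos ε κ hS z θ).le) (Finset.mem_univ y)

lemma measurable_simplex_apply {K : ℕ} (x : Fin K) : Measurable fun θ : Simplex K => θ x :=
  (measurable_pi_apply x).comp measurable_subtype_coe

lemma measurable_marginal {K : ℕ} (ε κ : ℝ) (S : Finset (Fin K)) (y : Fin K) :
    Measurable (marginal ε κ S y) :=
  Finset.measurable_sum _ fun x _ => (measurable_simplex_apply x).const_mul _

lemma isProbabilityMeasure_posterior {K : ℕ} (ε κ : ℝ) (η : Prior K) {ι : Type} [Fintype ι]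
    (s : ι → Finset (Fin K)) (hs : ∀ i, s i ≠ Finset.univ) (y : ι → Fin K) :
    IsProbabilityMeasure (posterior ε κ η s y) := by
  have hprod_pos : ∀ θ, 0 < ∏ i, marginal ε κ (s i) (y i) θ := fun θ =>
    Finset.prod_pos fun i _ => marginal_pos ε κ (hs i) _ _
  have hprod_le : ∀ θ, ∏ i, marginal ε κ (s i) (y i) θ ≤ 1 := fun θ =>
    Finset.prod_le_one (fun i _ => (marginal_pos ε κ (hs i) _ _).le)
      fun i _ => marginal_le_one ε κ (hs i) _ _
  have hmeas : Measurable fun θ =>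
      ENNReal.ofReal (η.density θ * ∏ i, marginal ε κ (s i) (y i) θ) :=
    (η.measurable_density.mul
      (Finset.measurable_prod _ fun i _ => measurable_marginal _ _ _ _)).ennreal_ofReal
  have hZ : posteriorWeight ε κ η s y Set.univ = ∫⁻ θ, ENNReal.ofReal
      (η.density θ * ∏ i, marginal ε κ (s i) (y i) θ) ∂(simplexVolume K) := by
    rw [posteriorWeight, withDensity_apply _ MeasurableSet.univ, Measure.restrict_univ]
  have htop : posteriorWeight ε κ η s y Set.univ ≠ ⊤ := by
    rw [hZ]
    refine ne_top_of_le_ne_top ENNReal.one_ne_top ?_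
    rw [← η.lintegral_density]
    refine lintegral_mono fun θ => ENNReal.ofReal_le_ofReal ?_
    exact mul_le_of_le_one_right (η.density_nonneg θ) (hprod_le θ)
  have hzero : posteriorWeight ε κ η s y Set.univ ≠ 0 := by
    rw [hZ]
    intro h
    rw [lintegral_eq_zero_iff hmeas] at h
    have h0 : ∫⁻ θ, ENNReal.ofReal (η.density θ) ∂(simplexVolume K) = 0 := by
      rw [lintegral_eq_zero_iff η.measurable_density.ennreal_ofReal]
      filter_upwards [h] with θ hθ
      simp only [Pi.zero_apply, ENNReal.ofReal_eq_zero] at hθ ⊢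
      by_contra! hlt
      exact absurd (mul_pos hlt (hprod_pos θ)) (not_lt.mpr hθ)
    rw [η.lintegral_density] at h0
    exact one_ne_zero h0
  constructor
  rw [posterior, Measure.smul_apply, smul_eq_mul, ENNReal.inv_mul_cancel hzero htop]

/-! ### The law of the algorithm -/

/-- The law of the response obtained with the subset `S` in a population with parameter `θ`. -/
def responseLaw {K : ℕ} (ε κ : ℝ) (θ : Simplex K) (S : Finset (Fin K)) : Measure (Fin K) :=
  ∑ y, ENNReal.ofReal (marginal ε κ S y θ) • Measure.dirac y

lemma isProbabilityMeasure_responseLaw {K : ℕ} (ε κ : ℝ) (θ : Simplex K) {S : Finset (Fin K)}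
    (hS : S ≠ Finset.univ) : IsProbabilityMeasure (responseLaw ε κ θ S) := by
  constructor
  simp only [responseLaw, Measure.coe_finsetSum, Finset.sum_apply, Measure.smul_apply,
    measure_univ, smul_eq_mul, mul_one]
  rw [← ENNReal.ofReal_sum_of_nonneg fun y _ => (marginal_pos ε κ hS y θ).le,
    marginal_sum ε κ hS, ENNReal.ofReal_one]

section Law

variable {K : ℕ} {U : Simplex K → Finset (Fin K) → ℝ → ℝ} {ε : ℝ}

lemma SelectionRule.best_ne_univ (R : SelectionRule U ε) (θ : Simplex K) :
    R.best θ ≠ Finset.univ := topSet_ne_univ _ _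

/-- One round of the algorithm as a state: the parameter `Θ_n` on which the selection of `S_{n+1}`
is based, together with the response `Y_{n+1}` obtained with that subset. -/
abbrev State (K : ℕ) : Type := Simplex K × Fin K

/-- The subsets used and the responses collected in a finite history. -/
def record (R : SelectionRule U ε) {n : ℕ} (w : Finset.Iic n → State K) :
    Finset.Iic n → Finset (Fin K) × Fin K :=
  fun i => (R.best (w i).1, (w i).2)

lemma measurable_record (R : SelectionRule U ε) (n : ℕ) :
    Measurable (record R : (Finset.Iic n → State K) → _) :=
  measurable_pi_lambda _ fun i =>
    ((R.measurable_topSet.comp measurable_fst).prodMk measurable_snd).comp (measurable_pi_apply i)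

/-- Exact posterior sampling: given the history, the next parameter is drawn from the posterior
distribution given the subsets used and the responses collected so far. -/
def samplingKernel (κ : ℝ) (η : Prior K) (R : SelectionRule U ε) (n : ℕ) :
    Kernel (Finset.Iic n → State K) (Simplex K) :=
  (Kernel.ofFunOfCountable fun r : Finset.Iic n → Finset (Fin K) × Fin K =>
    posterior ε κ η (fun i => (r i).1) (fun i => (r i).2)).comap (record R) (measurable_record R n)

instance (κ : ℝ) (η : Prior K) (R : SelectionRule U ε) (n : ℕ) :
    IsMarkovKernel (samplingKernel κ η R n) :=
  ⟨fun w => isProbabilityMeasure_posterior ε κ η (fun i => R.best (w i).1)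
    (fun _ => R.best_ne_univ _) (fun i => (w i).2)⟩

/-- Response generation: given the current parameter `ϑ`, the subset `S*_ϑ` is used on an individual
from the population with parameter `θ`. -/
def responseKernel (κ : ℝ) (R : SelectionRule U ε) (θ : Simplex K) : Kernel (Simplex K) (Fin K) :=
  (Kernel.ofFunOfCountable (responseLaw ε κ θ)).comap R.best R.measurable_topSet

instance (κ : ℝ) (R : SelectionRule U ε) (θ : Simplex K) :
    IsMarkovKernel (responseKernel κ R θ) :=
  ⟨fun ϑ => isProbabilityMeasure_responseLaw ε κ θ (R.best_ne_univ ϑ)⟩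

/-- One step of the algorithm in a population with parameter `θ`. -/
def stepKernel (κ : ℝ) (η : Prior K) (R : SelectionRule U ε) (θ : Simplex K) (n : ℕ) :
    Kernel (Finset.Iic n → State K) (State K) :=
  samplingKernel κ η R n ⊗ₖ Kernel.prodMkLeft (Finset.Iic n → State K) (responseKernel κ R θ)

instance (κ : ℝ) (η : Prior K) (R : SelectionRule U ε) (θ : Simplex K) (n : ℕ) :
    IsMarkovKernel (stepKernel κ η R θ n) := by
  unfold stepKernel; infer_instance

/-- The law `P_θ` of the whole run `((Θ_n, Y_{n+1}))_{n ≥ 0}` of the algorithm with exact posterior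
sampling in a population with parameter `θ`, started from `Θ_0 = θinit`. -/
def runLaw (κ : ℝ) (η : Prior K) (R : SelectionRule U ε) (θ θinit : Simplex K) :
    Measure (ℕ → State K) :=
  Kernel.trajMeasure (X := fun _ => State K)
    ((Measure.dirac θinit) ⊗ₘ (responseKernel κ R θ)) (stepKernel κ η R θ)

/-- The subset `S_t`, `t ≥ 1`, selected at time `t` from `Θ_{t-1}`. -/
def selected (R : SelectionRule U ε) (t : ℕ) (w : ℕ → State K) : Finset (Fin K) :=
  R.best (w (t - 1)).1

end Law

/-- The prior density is positive near `θ₀` and its ratios to the values there are bounded. -/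
def PriorCondition {K : ℕ} (η : Prior K) (θ₀ : Simplex K) : Prop :=
  ∃ d B : ℝ, 0 < d ∧ 0 < B ∧ ∀ θ θ' : Simplex K,
    ‖WithLp.toLp 2 ((θ' : Fin K → ℝ) - (θ₀ : Fin K → ℝ))‖ < d →
      0 < η.density θ' ∧ η.density θ / η.density θ' < B

end AdOBEst

end

/-!
For every proper subset `S` the channel `g_{S,ε}` is injective on probability vectors, so the
Hellinger affinity of the response laws under `θ₁ ≠ θ*` is at most some `r < 1`, uniformly over
the finitely many `S`. The posterior mass of a small neighbourhood `V` of `θ₁` is at most a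
constant times the square of `∏ c √(h(yₜ|θ₁) / h(yₜ|θ*))`, with `c > 1` as close to `1` as desired
once `V` is small, because the prior charges every neighbourhood of `θ*`; being at most `1`, it is
also bounded by the square root of that. Each factor has conditional expectation at most `c r < 1`
given the past, however the subsets are chosen, so the expected mass of `V` decays geometrically.
By compactness of the simplex `Θₙ → θ*` in probability, and the selected subset is constant near
`θ*`.
-/

open MeasureTheory ProbabilityTheory Filter Topology
open scoped ENNReal

noncomputable section

namespace AdOBEst

/-! ### Measure-theoretic and asymptotic preliminaries -/

/-- The Hellinger affinity (Bhattacharyya coefficient) of two weight functions on a finite type. -/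
def affinity {ι : Type*} [Fintype ι] (p q : ι → ℝ) : ℝ := ∑ i, √(p i * q i)

lemma affinity_eq_one_sub_sum_sq {ι : Type*} [Fintype ι] {p q : ι → ℝ} (hp : p ∈ stdSimplex ℝ ι)
    (hq : q ∈ stdSimplex ℝ ι) : affinity p q = 1 - (∑ i, (√(p i) - √(q i)) ^ 2) / 2 := by
  have hterm (i : ι) : (√(p i) - √(q i)) ^ 2 = p i + q i - 2 * √(p i * q i) := by
    rw [sub_sq, Real.sq_sqrt (hp.1 i), Real.sq_sqrt (hq.1 i), Real.sqrt_mul (hp.1 i)]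
    ring
  simp_rw [hterm, Finset.sum_sub_distrib, Finset.sum_add_distrib, ← Finset.mul_sum, hp.2, hq.2,
    affinity]
  ring

lemma affinity_lt_one {ι : Type*} [Fintype ι] {p q : ι → ℝ} (hp : p ∈ stdSimplex ℝ ι)
    (hq : q ∈ stdSimplex ℝ ι) (hpq : p ≠ q) : affinity p q < 1 := by
  obtain ⟨i, hi⟩ := Function.ne_iff.mp hpq
  have hroot : √(p i) - √(q i) ≠ 0 :=
    sub_ne_zero.mpr fun h => hi ((Real.sqrt_inj (hp.1 i) (hq.1 i)).mp h)
  have hdist : 0 < ∑ i, (√(p i) - √(q i)) ^ 2 :=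
    Finset.sum_pos' (fun _ _ => sq_nonneg _) ⟨i, Finset.mem_univ i, by positivity⟩
  rw [affinity_eq_one_sub_sum_sq hp hq]
  linarith

lemma measure_pos_of_mem_nhdsWithin_of_convex {E : Type*} [NormedAddCommGroup E] [NormedSpace ℝ E]
    [MeasurableSpace E] [BorelSpace E] [FiniteDimensional ℝ E] {μ : Measure E}
    [μ.IsAddHaarMeasure] {s t : Set E} {x : E} (hs : Convex ℝ s) (hμs : μ s ≠ 0) (hx : x ∈ s)
    (ht : t ∈ 𝓝[s] x) : 0 < μ t := by
  have hint : (interior s).Nonempty := by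
    refine nonempty_of_measure_ne_zero (μ := μ) ?_
    rwa [measure_congr (interior_ae_eq_of_null_frontier (hs.addHaar_frontier μ))]
  obtain ⟨u, hu, hxu, hut⟩ := mem_nhdsWithin.mp ht
  have hxcl : x ∈ closure (interior s) := by
    rw [hs.closure_interior_eq_closure_of_nonempty_interior hint]
    exact subset_closure hx
  calc 0 < μ (u ∩ interior s) :=
        (hu.inter isOpen_interior).measure_pos μ (mem_closure_iff.mp hxcl u hu hxu)
    _ ≤ μ t := measure_mono ((Set.inter_subset_inter_right u interior_subset).trans hut)

lemma setLIntegral_div_lintegral_le {α : Type*} [MeasurableSpace α] {μ : Measure α}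
    [IsProbabilityMeasure μ] {f : α → ℝ≥0∞} {V W : Set α} (hV : MeasurableSet V)
    (hW : MeasurableSet W) {a b : ℝ≥0∞} (hfV : ∀ x ∈ V, f x ≤ a) (hfW : ∀ x ∈ W, b ≤ f x) :
    (∫⁻ x in V, f x ∂μ) / ∫⁻ x, f x ∂μ ≤ a / (b * μ W) := by
  refine ENNReal.div_le_div ?_ ?_
  · calc ∫⁻ x in V, f x ∂μ ≤ ∫⁻ _ in V, a ∂μ := setLIntegral_mono' hV hfV
      _ = a * μ V := setLIntegral_const V a
      _ ≤ a := mul_le_of_le_one_right' prob_le_one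
  · calc b * μ W = ∫⁻ _ in W, b ∂μ := (setLIntegral_const W b).symm
      _ ≤ ∫⁻ x in W, f x ∂μ := setLIntegral_mono' hW hfW
      _ ≤ ∫⁻ x, f x ∂μ := setLIntegral_le_lintegral W f

section Trajectory

variable {X : ℕ → Type*} [∀ n, MeasurableSpace (X n)] {μ₀ : Measure (X 0)}
  {κ : (n : ℕ) → Kernel (Π i : Finset.Iic n, X i) (X (n + 1))}
  [∀ n, IsMarkovKernel (κ n)]

lemma map_eval_zero_trajMeasure : (Kernel.trajMeasure μ₀ κ).map (fun w => w 0) = μ₀ := by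
  let restrictZero : (Π i : Finset.Iic 0, X i) → X 0 := fun h => h ⟨0, Finset.mem_Iic.mpr le_rfl⟩
  have hmeas : Measurable restrictZero := by fun_prop
  calc (Kernel.trajMeasure μ₀ κ).map (fun w => w 0)
      = ((Kernel.trajMeasure μ₀ κ).map (Preorder.frestrictLe 0)).map restrictZero :=
        (Measure.map_map hmeas (Preorder.measurable_frestrictLe 0)).symm
    _ = (μ₀.map (MeasurableEquiv.piUnique _).symm).map restrictZero := by
        rw [Kernel.trajMeasure, Measure.map_comp _ _ (by fun_prop), Kernel.traj_map_frestrictLe,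
          Kernel.partialTraj_self, Measure.id_comp]
    _ = μ₀.map id := Measure.map_map hmeas (MeasurableEquiv.measurable _)
    _ = μ₀ := Measure.map_id

variable [IsProbabilityMeasure μ₀]

lemma lintegral_trajMeasure_succ {n : ℕ} {f : (Π i : Finset.Iic n, X i) × X (n + 1) → ℝ≥0∞}
    (hf : Measurable f) :
    ∫⁻ w, f (Preorder.frestrictLe n w, w (n + 1)) ∂(Kernel.trajMeasure μ₀ κ) =
      ∫⁻ w, ∫⁻ x, f (Preorder.frestrictLe n w, x) ∂(κ n (Preorder.frestrictLe n w))
        ∂(Kernel.trajMeasure μ₀ κ) := by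
  rw [← lintegral_map (g := fun w : Π n, X n => (Preorder.frestrictLe n w, w (n + 1))) hf
      (by fun_prop), ← Kernel.map_frestrictLe_trajMeasure_compProd_eq_map_trajMeasure,
    Measure.lintegral_compProd hf, lintegral_map hf.lintegral_kernel_prod_right' (by fun_prop)]

lemma lintegral_prod_trajMeasure_le {f : ∀ n, X n → ℝ≥0∞} (hf : ∀ n, Measurable (f n)) {r : ℝ≥0∞}
    (hzero : ∫⁻ x, f 0 x ∂μ₀ ≤ r) (hsucc : ∀ n h, ∫⁻ x, f (n + 1) x ∂(κ n h) ≤ r) (n : ℕ) :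
    ∫⁻ w, ∏ i : Finset.Iic n, f i (w i) ∂(Kernel.trajMeasure μ₀ κ) ≤ r ^ (n + 1) := by
  simp_rw [fun w : Π n, X n => Finset.prod_coe_sort (Finset.Iic n) fun i => f i (w i),
    ← Nat.range_succ_eq_Iic]
  induction n with
  | zero =>
    simp only [zero_add, Finset.prod_range_one, pow_one]
    rwa [← lintegral_map (g := fun w : Π n, X n => w 0) (hf 0) (by fun_prop),
      map_eval_zero_trajMeasure]
  | succ n ih =>
    let past (h : Π i : Finset.Iic n, X i) : ℝ≥0∞ := ∏ i : Finset.Iic n, f i (h i)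
    have hpast_meas : Measurable past :=
      Finset.measurable_prod _ fun i _ => (hf i).comp (measurable_pi_apply i)
    have hpast (w : Π n, X n) :
        ∏ i ∈ Finset.range (n + 1), f i (w i) = past (Preorder.frestrictLe n w) := by
      rw [Nat.range_succ_eq_Iic]
      exact (Finset.prod_coe_sort (Finset.Iic n) fun i => f i (w i)).symm
    simp_rw [Finset.prod_range_succ _ (n + 1), hpast] at ih ⊢
    calc ∫⁻ w, past (Preorder.frestrictLe n w) * f (n + 1) (w (n + 1)) ∂(Kernel.trajMeasure μ₀ κ)
        = ∫⁻ w, past (Preorder.frestrictLe n w) *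
            ∫⁻ x, f (n + 1) x ∂(κ n (Preorder.frestrictLe n w)) ∂(Kernel.trajMeasure μ₀ κ) := by
          rw [lintegral_trajMeasure_succ (f := fun p => past p.1 * f (n + 1) p.2) (by fun_prop)]
          simp_rw [lintegral_const_mul _ (hf (n + 1))]
      _ ≤ ∫⁻ w, past (Preorder.frestrictLe n w) * r ∂(Kernel.trajMeasure μ₀ κ) := by
          gcongr with w
          exact hsucc n _
      _ = (∫⁻ w, past (Preorder.frestrictLe n w) ∂(Kernel.trajMeasure μ₀ κ)) * r :=
          lintegral_mul_const r (by fun_prop)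
      _ ≤ r ^ (n + 1) * r := by gcongr
      _ = r ^ (n + 1 + 1) := (pow_succ r (n + 1)).symm

end Trajectory

section ConvergenceInMeasure

variable {Ω ι X : Type*} [MeasurableSpace Ω] {μ : Measure Ω} {l : Filter ι}

lemma tendsto_measure_preimage_zero_of_isCompact [TopologicalSpace X] {f : ι → Ω → X} {B : Set X}
    (hB : IsCompact B)
    (h : ∀ x ∈ B, ∃ V ∈ 𝓝 x, Tendsto (fun i => μ (f i ⁻¹' V)) l (𝓝 0)) :
    Tendsto (fun i => μ (f i ⁻¹' B)) l (𝓝 0) := by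
  refine hB.induction_on (p := fun C => Tendsto (fun i => μ (f i ⁻¹' C)) l (𝓝 0)) ?_ ?_ ?_ ?_
  · simpa only [Set.preimage_empty, measure_empty] using tendsto_const_nhds
  · exact fun C D hCD hD => tendsto_of_tendsto_of_tendsto_of_le_of_le tendsto_const_nhds hD
      (fun _ => zero_le) fun _ => measure_mono (Set.preimage_mono hCD)
  · intro C D hC hD
    have hCD := hC.add hD
    rw [add_zero] at hCD
    exact tendsto_of_tendsto_of_tendsto_of_le_of_le tendsto_const_nhds hCD
      (fun _ => zero_le) fun _ => measure_union_le _ _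
  · intro x hx
    obtain ⟨V, hV, hlim⟩ := h x hx
    exact ⟨V, nhdsWithin_le_nhds hV, hlim⟩

lemma tendstoInMeasure_const_of_forall_ne [PseudoEMetricSpace X] [CompactSpace X] {f : ι → Ω → X}
    {x₀ : X} (h : ∀ x ≠ x₀, ∃ V ∈ 𝓝 x, Tendsto (fun i => μ (f i ⁻¹' V)) l (𝓝 0)) :
    TendstoInMeasure μ f l fun _ => x₀ := by
  intro δ hδ
  have hclosed : IsClosed {x : X | δ ≤ edist x x₀} :=
    isClosed_le continuous_const (continuous_id.edist continuous_const)
  refine tendsto_measure_preimage_zero_of_isCompact hclosed.isCompact fun x hx => h x ?_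
  rintro rfl
  exact hδ.not_ge (by simpa only [Set.mem_ofPred_eq, edist_self] using hx)

lemma tendsto_measure_notMem_zero_of_tendstoInMeasure_const [PseudoEMetricSpace X]
    {f : ι → Ω → X} {x₀ : X} (h : TendstoInMeasure μ f l fun _ => x₀) {A : Set X}
    (hA : A ∈ 𝓝 x₀) : Tendsto (fun i => μ {ω | f i ω ∉ A}) l (𝓝 0) := by
  obtain ⟨δ, hδ, hball⟩ := EMetric.mem_nhds_iff.mp hA
  refine tendsto_of_tendsto_of_tendsto_of_le_of_le tendsto_const_nhds (h δ hδ)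
    (fun _ => zero_le) fun i => measure_mono fun ω hω => ?_
  change δ ≤ edist (f i ω) x₀
  exact le_of_not_gt fun hlt => hω (hball hlt)

lemma tendsto_measureReal_one_of_compl [IsProbabilityMeasure μ] {A : ι → Set Ω}
    (hA : ∀ i, MeasurableSet (A i)) (h : Tendsto (fun i => μ (A i)ᶜ) l (𝓝 0)) :
    Tendsto (fun i => μ.real (A i)) l (𝓝 1) := by
  have hreal := ((ENNReal.tendsto_toReal ENNReal.zero_ne_top).comp h).const_sub 1
  rw [ENNReal.toReal_zero, sub_zero] at hreal
  refine hreal.congr fun i => ?_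
  change 1 - μ.real (A i)ᶜ = μ.real (A i)
  rw [probReal_compl_eq_one_sub (hA i), sub_sub_cancel]

end ConvergenceInMeasure

lemma tendsto_one_div_mul_sum_Icc {u : ℕ → ℝ} {a : ℝ} (h : Tendsto u atTop (𝓝 a)) :
    Tendsto (fun n : ℕ => 1 / (n : ℝ) * ∑ t ∈ Finset.Icc 1 n, u t) atTop (𝓝 a) := by
  refine (((tendsto_add_atTop_iff_nat 1).mpr h).cesaro).congr fun n => ?_
  rw [one_div, ← Finset.Ico_add_one_right_eq_Icc, Finset.sum_Ico_eq_sum_range]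
  simp_rw [add_tsub_cancel_right, add_comm]

/-! ### Identifiability of the mechanism -/

section Identifiability

variable {K : ℕ} {ε κ : ℝ} {S : Finset (Fin K)}

lemma srr_of_mem {Ω : Finset (Fin K)} {x y : Fin K} (hx : x ∈ Ω) (hy : y ∈ Ω) (e : ℝ) :
    srr Ω e x y = (if y = x then Real.exp e else 1) / (Real.exp e + (Ω.card : ℝ) - 1) := by
  have hden := srr_denom_pos hx e
  rw [srr, if_pos hy, ite_div]
  refine ite_congr rfl (fun _ => rfl) fun hyx => ?_
  have hcard : (1 : ℝ) < Ω.card := Nat.one_lt_cast.mpr (Finset.one_lt_card.mpr ⟨y, hy, x, hx, hyx⟩)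
  have hoff : (Ω.card : ℝ) - 1 ≠ 0 := (sub_pos.mpr hcard).ne'
  field_simp
  ring

lemma rrrr_of_mem (hS : S ≠ Finset.univ) {y : Fin K} (hy : y ∈ S) (x : Fin K) :
    rrrr ε κ S y x =
      (if y = x then Real.exp (κ * ε) else 1) / (Real.exp (κ * ε) + (S.card : ℝ)) := by
  have hcard : (Sᶜ.card : ℝ) ≠ 0 := by exact_mod_cast (compl_nonempty hS).card_pos.ne'
  have hsrr {z r : Fin K} (hr : r ∈ Sᶜ) (hz : z ∈ insert r S) :
      srr (insert r S) (κ * ε) z y =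
        (if y = z then Real.exp (κ * ε) else 1) / (Real.exp (κ * ε) + (S.card : ℝ)) := by
    rw [srr_of_mem hz (Finset.mem_insert_of_mem hy),
      Finset.card_insert_of_notMem (Finset.mem_compl.mp hr), Nat.cast_succ, ← add_assoc,
      add_sub_cancel_right]
  rw [rrrr]
  by_cases hx : x ∈ S
  · rw [if_pos hx, ← Finset.mul_sum,
      Finset.sum_congr rfl fun r hr => hsrr hr (Finset.mem_insert_of_mem hx), Finset.sum_const,
      nsmul_eq_mul, ← mul_assoc, one_div_mul_cancel hcard, one_mul]
  · have hne {r : Fin K} (hr : r ∈ Sᶜ) : y ≠ r := fun h => Finset.mem_compl.mp hr (h ▸ hy)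
    rw [if_neg hx, if_neg (hne (Finset.mem_compl.mpr hx)), Finset.sum_congr rfl fun r hr => by
      rw [hsrr hr (Finset.mem_insert_self r S), if_neg (hne hr)], ← Finset.sum_mul,
      srr_sum (Finset.mem_compl.mpr hx), one_mul]

lemma rrrr_of_notMem {x y : Fin K} (hx : x ∉ S) (hy : y ∉ S) :
    rrrr ε κ S y x = srr Sᶜ (eps2 ε (κ * ε) S) x y * srr (insert y S) (κ * ε) y y := by
  rw [rrrr, if_neg hx]
  refine Finset.sum_eq_single_of_mem y (Finset.mem_compl.mpr hy) fun r _ hry => ?_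
  have hyr : y ∉ insert r S := Finset.mem_insert.not.mpr (not_or.mpr ⟨hry.symm, hy⟩)
  rw [srr_eq_zero (Finset.mem_insert_self r S) hyr, mul_zero]

lemma eps2_pos {ε₁ : ℝ} (hε : 0 < ε) (hε₁ : ε₁ < ε) (S : Finset (Fin K)) : 0 < eps2 ε ε₁ S := by
  rw [eps2]
  split_ifs with hcase
  · refine lt_min hε (Real.log_pos ?_)
    have hcard : (0 : ℝ) < Sᶜ.card := by
      refine Nat.cast_pos.mpr (Nat.pos_of_ne_zero fun h => ?_)
      rw [h, Nat.cast_zero, Real.log_zero] at hcase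
      linarith [hcase.1]
    have hden : 0 < Real.exp (ε₁ - ε) * Sᶜ.card - 1 := by
      rw [sub_pos, ← neg_sub, Real.exp_neg, inv_mul_eq_div, one_lt_div (Real.exp_pos _)]
      exact (Real.lt_log_iff_exp_lt hcard).mp hcase.1
    rw [one_lt_div hden]
    have hexp : Real.exp (ε₁ - ε) < 1 := Real.exp_lt_one_iff.mpr (sub_neg.mpr hε₁)
    gcongr
    exact mul_lt_of_lt_one_left hcard hexp
  · exact hε

lemma eq_zero_of_sum_mul_eq_zero {ι : Type*} [DecidableEq ι] {T : Finset ι} {a b : ℝ}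
    (ha : a ≠ 1) (hb : b ≠ 0) {w δ : ι → ℝ} {y : ι} (hy : y ∈ T)
    (hw : ∀ x ∈ T, w x = (if y = x then a else 1) / b) (hδ : ∑ x ∈ T, δ x = 0)
    (hwδ : ∑ x ∈ T, w x * δ x = 0) : δ y = 0 := by
  have hsplit : ∀ x ∈ T, w x * δ x = (if y = x then (a - 1) / b * δ x else 0) + b⁻¹ * δ x := by
    intro x hx
    rw [hw x hx]
    split_ifs <;> ring
  rw [Finset.sum_congr rfl hsplit, Finset.sum_add_distrib, ← Finset.mul_sum, hδ, mul_zero,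
    add_zero, Finset.sum_ite_eq, if_pos hy] at hwδ
  exact (mul_eq_zero.mp hwδ).resolve_left (div_ne_zero (sub_ne_zero.mpr ha) hb)

lemma eq_zero_of_sum_rrrr_mul_eq_zero (hS : S ≠ Finset.univ) (hε₁ : κ * ε ≠ 0)
    (hε₂ : eps2 ε (κ * ε) S ≠ 0) {δ : Fin K → ℝ} (hδ : ∑ x, δ x = 0)
    (h : ∀ y, ∑ x, rrrr ε κ S y x * δ x = 0) : δ = 0 := by
  have hin : ∀ y ∈ S, δ y = 0 := fun y hy =>
    eq_zero_of_sum_mul_eq_zero (Real.exp_eq_one_iff _ |>.not.mpr hε₁)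
      (by positivity : Real.exp (κ * ε) + (S.card : ℝ) ≠ 0) (Finset.mem_univ y)
      (fun x _ => rrrr_of_mem hS hy x) hδ (h y)
  have hcompl (w : Fin K → ℝ) : ∑ x ∈ Sᶜ, w x * δ x = ∑ x, w x * δ x :=
    Finset.sum_subset (Finset.subset_univ _) fun x _ hx => by
      rw [hin x (Finset.notMem_compl.mp hx), mul_zero]
  have hδ' : ∑ x ∈ Sᶜ, δ x = 0 := by simpa only [one_mul, hδ] using hcompl fun _ => 1
  have hout : ∀ y ∉ S, δ y = 0 := by
    intro y hy
    have hyc := Finset.mem_compl.mpr hy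
    have hself := srr_pos (Finset.mem_insert_self y S) (Finset.mem_insert_self y S) (κ * ε)
    refine eq_zero_of_sum_mul_eq_zero (Real.exp_eq_one_iff _ |>.not.mpr hε₂)
      (div_pos (srr_denom_pos hyc (eps2 ε (κ * ε) S)) hself).ne' hyc (fun x hx => ?_) hδ'
      ((hcompl _).trans (h y))
    rw [rrrr_of_notMem (Finset.mem_compl.mp hx) hy, srr_of_mem hx hyc, div_div_eq_mul_div,
      div_mul_eq_mul_div]
  funext y
  by_cases hy : y ∈ S
  exacts [hin y hy, hout y hy]

lemma marginal_injective (hS : S ≠ Finset.univ) (hε₁ : κ * ε ≠ 0) (hε₂ : eps2 ε (κ * ε) S ≠ 0) :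
    Function.Injective fun (θ : Simplex K) (y : Fin K) => marginal ε κ S y θ := by
  intro θ θ' h
  refine Subtype.ext (sub_eq_zero.mp (eq_zero_of_sum_rrrr_mul_eq_zero hS hε₁ hε₂ ?_ fun y => ?_))
  · simp only [Pi.sub_apply, Finset.sum_sub_distrib]
    exact sub_eq_zero.mpr ((simplex_sum θ).trans (simplex_sum θ').symm)
  · simp only [Pi.sub_apply, mul_sub, Finset.sum_sub_distrib]
    exact sub_eq_zero.mpr (congrFun h y)

lemma marginal_mem_stdSimplex (hS : S ≠ Finset.univ) (θ : Simplex K) :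
    (fun y => marginal ε κ S y θ) ∈ stdSimplex ℝ (Fin K) :=
  ⟨fun y => (marginal_pos ε κ hS y θ).le, marginal_sum ε κ hS θ⟩

lemma exists_affinity_marginal_le (hε : 0 < ε) (hκ₀ : 0 < κ) (hκ₁ : κ < 1) {θ θ' : Simplex K}
    (hne : θ ≠ θ') :
    ∃ r < 1, ∀ S ≠ Finset.univ,
      affinity (fun y => marginal ε κ S y θ) (fun y => marginal ε κ S y θ') ≤ r := by
  have hlt (S : Finset (Fin K)) (hS : S ≠ Finset.univ) :
      affinity (fun y => marginal ε κ S y θ) (fun y => marginal ε κ S y θ') < 1 :=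
    affinity_lt_one (marginal_mem_stdSimplex hS θ) (marginal_mem_stdSimplex hS θ')
      ((marginal_injective hS (mul_pos hκ₀ hε).ne'
        (eps2_pos hε (mul_lt_of_lt_one_left hε hκ₁) S).ne').ne hne)
  have heventually : ∀ᶠ r : ℝ in 𝓝[<] 1, ∀ S ≠ Finset.univ,
      affinity (fun y => marginal ε κ S y θ) (fun y => marginal ε κ S y θ') ≤ r := by
    simp only [eventually_all]
    intro S hS
    filter_upwards [nhdsWithin_le_nhds (lt_mem_nhds (hlt S hS))] with r hr using hr.le
  obtain ⟨r, hr, hr₁⟩ := (heventually.and eventually_mem_nhdsWithin).exists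
  exact ⟨r, hr₁, hr⟩

end Identifiability

/-! ### Support of the prior -/

section Prior

variable {K : ℕ}

lemma continuous_simplex_apply (x : Fin K) : Continuous fun θ : Simplex K => θ x :=
  (continuous_apply x).comp continuous_subtype_val

lemma continuous_marginal (ε κ : ℝ) (S : Finset (Fin K)) (y : Fin K) :
    Continuous (marginal ε κ S y) :=
  continuous_finsetSum _ fun x _ => (continuous_simplex_apply x).const_mul _

lemma continuous_freeCoords : Continuous (freeCoords : Simplex K → _) :=
  continuous_pi fun _ => continuous_simplex_apply _

lemma freeCoords_injective : Function.Injective (freeCoords : Simplex K → _) := by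
  intro θ θ' h
  obtain _ | n := K
  · exact Subtype.ext (funext fun i => i.elim0)
  · have hfree (i : Fin n) : θ i.castSucc = θ' i.castSucc := congrFun h i
    have hsum := (simplex_sum θ).trans (simplex_sum θ').symm
    simp_rw [Fin.sum_univ_castSucc, hfree, add_right_inj] at hsum
    exact Subtype.ext (funext (Fin.lastCases hsum hfree))

lemma isClosedEmbedding_freeCoords : IsClosedEmbedding (freeCoords : Simplex K → _) :=
  continuous_freeCoords.isClosedEmbedding freeCoords_injective

lemma simplexVolume_apply (A : Set (Simplex K)) : simplexVolume K A = volume (freeCoords '' A) :=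
  isClosedEmbedding_freeCoords.measurableEmbedding.comap_apply _ A

lemma convex_range_freeCoords : Convex ℝ (Set.range (freeCoords : Simplex K → _)) := by
  have hrange : Set.range (freeCoords : Simplex K → _) =
      LinearMap.funLeft ℝ ℝ (Fin.castLE (Nat.sub_le K 1)) '' stdSimplex ℝ (Fin K) := by
    rw [Set.image_eq_range]
    rfl
  rw [hrange]
  exact (convex_stdSimplex ℝ (Fin K)).linear_image _

lemma simplexVolume_pos_of_mem_nhds (hK : simplexVolume K ≠ 0) {θ : Simplex K}
    {W : Set (Simplex K)} (hW : W ∈ 𝓝 θ) : 0 < simplexVolume K W := by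
  rw [simplexVolume_apply]
  refine measure_pos_of_mem_nhdsWithin_of_convex convex_range_freeCoords ?_
    (Set.mem_range_self θ) ?_
  · rwa [← Set.image_univ, ← simplexVolume_apply, Measure.measure_univ_ne_zero]
  · rw [← isClosedEmbedding_freeCoords.isEmbedding.map_nhds_eq]
    exact image_mem_map hW

/-- The prior distribution itself, as opposed to its density. -/
def Prior.measure (η : Prior K) : Measure (Simplex K) :=
  (simplexVolume K).withDensity fun θ => ENNReal.ofReal (η.density θ)

instance (η : Prior K) : IsProbabilityMeasure η.measure :=
  ⟨by rw [Prior.measure, withDensity_apply _ .univ, Measure.restrict_univ, η.lintegral_density]⟩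

lemma Prior.simplexVolume_ne_zero (η : Prior K) : simplexVolume K ≠ 0 := by
  intro h
  have hη := η.lintegral_density
  rw [h, lintegral_zero_measure] at hη
  exact zero_ne_one hη

lemma Prior.mem_support_of_eventually_density_pos {η : Prior K} {θ₀ : Simplex K}
    (h : ∀ᶠ θ in 𝓝 θ₀, 0 < η.density θ) : θ₀ ∈ η.measure.support := by
  rw [Measure.mem_support_iff_forall]
  intro W hW
  rw [pos_iff_ne_zero, Prior.measure, ne_eq,
    withDensity_apply_eq_zero' η.measurable_density.ennreal_ofReal.aemeasurable]
  refine (simplexVolume_pos_of_mem_nhds η.simplexVolume_ne_zero (inter_mem ?_ hW)).ne'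
  filter_upwards [h] with θ hθ using (ENNReal.ofReal_pos.mpr hθ).ne'

lemma PriorCondition.eventually_density_pos {η : Prior K} {θ₀ : Simplex K}
    (h : PriorCondition η θ₀) : ∀ᶠ θ in 𝓝 θ₀, 0 < η.density θ := by
  obtain ⟨d, B, hd, -, hdB⟩ := h
  have hcont : Continuous fun θ : Simplex K =>
      ‖WithLp.toLp 2 ((θ : Fin K → ℝ) - (θ₀ : Fin K → ℝ))‖ :=
    ((PiLp.continuous_toLp 2 _).comp (continuous_subtype_val.sub continuous_const)).norm
  have hnear : ∀ᶠ θ : Simplex K in 𝓝 θ₀,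
      ‖WithLp.toLp 2 ((θ : Fin K → ℝ) - (θ₀ : Fin K → ℝ))‖ < d :=
    hcont.continuousAt.eventually_lt continuousAt_const
      (by rwa [sub_self, WithLp.toLp_zero, norm_zero])
  filter_upwards [hnear] with θ hθ using (hdB θ θ hθ).1

lemma PriorCondition.mem_support {η : Prior K} {θ₀ : Simplex K} (h : PriorCondition η θ₀) :
    θ₀ ∈ η.measure.support :=
  Prior.mem_support_of_eventually_density_pos h.eventually_density_pos

end Prior

/-! ### Stability of the selected subset -/

section Selection

variable {K : ℕ} {U : Simplex K → Finset (Fin K) → ℝ → ℝ} {ε : ℝ}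

lemma perm_eq_of_antitone_of_strictAnti {α : Type*} [PartialOrder α] {f : Fin K → α}
    {σ τ : Equiv.Perm (Fin K)} (hσ : Antitone (f ∘ σ)) (hτ : StrictAnti (f ∘ τ)) : σ = τ := by
  have hf : Function.Injective f := (τ.injective_comp f).mp hτ.injective
  have hcomp : f ∘ σ = f ∘ τ := Tuple.unique_monotone (α := αᵒᵈ) (f := f) hσ hτ.antitone
  exact Equiv.ext fun i => hf (congrFun hcomp i)

lemma eventually_strictAnti_comp {θ₀ : Simplex K} {σ : Equiv.Perm (Fin K)}
    (h : StrictAnti fun i => θ₀ (σ i)) : ∀ᶠ θ in 𝓝 θ₀, StrictAnti fun i => θ (σ i) := by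
  simp only [StrictAnti, eventually_all]
  exact fun i j hij => (continuous_simplex_apply _).continuousAt.eventually_lt
    (continuous_simplex_apply _).continuousAt (h hij)

lemma SelectionRule.eventually_σ_eq (R : SelectionRule U ε) {θ₀ : Simplex K}
    (horder : StrictAnti fun i => θ₀ (R.σ θ₀ i)) : ∀ᶠ θ in 𝓝 θ₀, R.σ θ = R.σ θ₀ := by
  filter_upwards [eventually_strictAnti_comp horder] with θ hθ
  exact perm_eq_of_antitone_of_strictAnti (R.sorted θ) hθ

lemma SelectionRule.lt_of_ne_k (R : SelectionRule U ε) {θ : Simplex K}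
    (hunique : ∃! k : Fin K, ∀ j : Fin K,
      U θ (topSet (R.σ θ) j) ε ≤ U θ (topSet (R.σ θ) k) ε) {j : Fin K} (hj : j ≠ R.k θ) :
    U θ (topSet (R.σ θ) j) ε < U θ (topSet (R.σ θ) (R.k θ)) ε := by
  by_contra! hle
  exact hj (hunique.unique (fun i => (R.maximal θ i).trans hle) (R.maximal θ))

lemma SelectionRule.eventually_best_eq (R : SelectionRule U ε) {θ₀ : Simplex K}
    (horder : StrictAnti fun i => θ₀ (R.σ θ₀ i))
    (hcont : ∀ j, ContinuousAt (fun θ => U θ (topSet (R.σ θ₀) j) ε) θ₀)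
    (hunique : ∃! k : Fin K, ∀ j : Fin K,
      U θ₀ (topSet (R.σ θ₀) j) ε ≤ U θ₀ (topSet (R.σ θ₀) k) ε) :
    ∀ᶠ θ in 𝓝 θ₀, R.best θ = R.best θ₀ := by
  have hlt : ∀ᶠ θ in 𝓝 θ₀, ∀ j ≠ R.k θ₀,
      U θ (topSet (R.σ θ₀) j) ε < U θ (topSet (R.σ θ₀) (R.k θ₀)) ε := by
    simp only [eventually_all]
    exact fun j hj => (hcont j).eventually_lt (hcont _) (R.lt_of_ne_k hunique hj)
  filter_upwards [R.eventually_σ_eq horder, hlt] with θ hσ hθ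
  have hk : R.k θ = R.k θ₀ := by
    by_contra hne
    have hmax := R.maximal θ (R.k θ₀)
    rw [hσ] at hmax
    exact (hθ _ hne).not_ge hmax
  rw [SelectionRule.best, SelectionRule.best, hσ, hk]

end Selection

/-! ### Posterior mass near a wrong parameter -/

section Posterior

variable {K : ℕ} {ε κ : ℝ}

lemma posteriorWeight_eq_withDensity (η : Prior K) {ι : Type} [Fintype ι]
    (s : ι → Finset (Fin K)) (y : ι → Fin K) :
    posteriorWeight ε κ η s y =
      η.measure.withDensity fun θ => ENNReal.ofReal (∏ i, marginal ε κ (s i) (y i) θ) := by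
  have hlik : Measurable fun θ => ENNReal.ofReal (∏ i, marginal ε κ (s i) (y i) θ) :=
    (Finset.measurable_prod _ fun i _ => measurable_marginal _ _ _ _).ennreal_ofReal
  rw [Prior.measure, ← withDensity_mul _ η.measurable_density.ennreal_ofReal hlik, posteriorWeight]
  simp_rw [ENNReal.ofReal_mul (η.density_nonneg _)]
  rfl

lemma posterior_apply (η : Prior K) {ι : Type} [Fintype ι] (s : ι → Finset (Fin K))
    (y : ι → Fin K) {V : Set (Simplex K)} (hV : MeasurableSet V) :
    posterior ε κ η s y V =
      (∫⁻ θ in V, ENNReal.ofReal (∏ i, marginal ε κ (s i) (y i) θ) ∂η.measure) /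
        ∫⁻ θ, ENNReal.ofReal (∏ i, marginal ε κ (s i) (y i) θ) ∂η.measure := by
  rw [posterior, posteriorWeight_eq_withDensity, Measure.smul_apply, smul_eq_mul,
    withDensity_apply _ hV, withDensity_apply _ .univ, Measure.restrict_univ,
    ENNReal.div_eq_inv_mul]

/-- The square root of the likelihood ratio of `θ₁` and `θ₀` for a single response `y` obtained with
the subset `S`. It takes values in `ℝ≥0∞` because it is only ever integrated. -/
def rootLikelihoodRatio (ε κ : ℝ) (θ₁ θ₀ : Simplex K) (S : Finset (Fin K)) (y : Fin K) : ℝ≥0∞ :=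
  ENNReal.ofReal √(marginal ε κ S y θ₁ / marginal ε κ S y θ₀)

lemma lintegral_responseLaw (θ : Simplex K) (S : Finset (Fin K)) (f : Fin K → ℝ≥0∞) :
    ∫⁻ y, f y ∂(responseLaw ε κ θ S) = ∑ y, ENNReal.ofReal (marginal ε κ S y θ) * f y := by
  simp only [responseLaw, lintegral_finsetSum_measure, lintegral_smul_measure, lintegral_dirac,
    smul_eq_mul]

lemma lintegral_rootLikelihoodRatio {S : Finset (Fin K)} (hS : S ≠ Finset.univ)
    (θ₁ θ₀ : Simplex K) :
    ∫⁻ y, rootLikelihoodRatio ε κ θ₁ θ₀ S y ∂(responseLaw ε κ θ₀ S) = ENNReal.ofReal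
      (affinity (fun y => marginal ε κ S y θ₁) (fun y => marginal ε κ S y θ₀)) := by
  rw [lintegral_responseLaw, affinity, ENNReal.ofReal_sum_of_nonneg fun _ _ => Real.sqrt_nonneg _]
  refine Finset.sum_congr rfl fun y _ => ?_
  have hpos := marginal_pos ε κ hS y θ₀
  rw [rootLikelihoodRatio, ← ENNReal.ofReal_mul hpos.le]
  congr 1
  calc marginal ε κ S y θ₀ * √(marginal ε κ S y θ₁ / marginal ε κ S y θ₀)
      = √(marginal ε κ S y θ₀ ^ 2 * (marginal ε κ S y θ₁ / marginal ε κ S y θ₀)) := by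
        rw [Real.sqrt_mul (sq_nonneg _), Real.sqrt_sq hpos.le]
    _ = √(marginal ε κ S y θ₁ * marginal ε κ S y θ₀) := by
        congr 1
        field_simp

lemma eventually_marginal_le_mul (θ₀ : Simplex K) {c : ℝ} (hc : 1 < c) :
    ∀ᶠ θ in 𝓝 θ₀, ∀ S ≠ Finset.univ, ∀ y,
      marginal ε κ S y θ ≤ c * marginal ε κ S y θ₀ ∧
        marginal ε κ S y θ₀ ≤ c * marginal ε κ S y θ := by
  simp only [eventually_all]
  intro S hS y
  have hlt : marginal ε κ S y θ₀ < c * marginal ε κ S y θ₀ :=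
    lt_mul_of_one_lt_left (marginal_pos ε κ hS y θ₀) hc
  have hcont := (continuous_marginal ε κ S y).continuousAt (x := θ₀)
  filter_upwards [hcont.eventually_lt continuousAt_const hlt,
    continuousAt_const.eventually_lt (hcont.const_mul c) hlt] with θ h h' using ⟨h.le, h'.le⟩

lemma posterior_le_inv_mul_prod_sq (η : Prior K) {θ₀ θ₁ : Simplex K} {c : ℝ} (hc : 0 < c)
    {V W : Set (Simplex K)} (hVm : MeasurableSet V) (hWm : MeasurableSet W)
    (hV : ∀ θ ∈ V, ∀ S ≠ Finset.univ, ∀ y, marginal ε κ S y θ ≤ c * marginal ε κ S y θ₁)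
    (hW : ∀ θ ∈ W, ∀ S ≠ Finset.univ, ∀ y, marginal ε κ S y θ₀ ≤ c * marginal ε κ S y θ)
    {ι : Type} [Fintype ι] {s : ι → Finset (Fin K)} (hs : ∀ i, s i ≠ Finset.univ)
    (y : ι → Fin K) :
    posterior ε κ η s y V ≤ (η.measure W)⁻¹ *
      (∏ i, ENNReal.ofReal c * rootLikelihoodRatio ε κ θ₁ θ₀ (s i) (y i)) ^ 2 := by
  have hpos (i : ι) (θ : Simplex K) := marginal_pos ε κ (hs i) (y i) θ
  have hlower : 0 < ∏ i, marginal ε κ (s i) (y i) θ₀ / c :=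
    Finset.prod_pos fun i _ => div_pos (hpos i θ₀) hc
  have hsq (i : ι) : (c * √(marginal ε κ (s i) (y i) θ₁ / marginal ε κ (s i) (y i) θ₀)) ^ 2 =
      (c * marginal ε κ (s i) (y i) θ₁) / (marginal ε κ (s i) (y i) θ₀ / c) := by
    rw [mul_pow, Real.sq_sqrt (div_pos (hpos i θ₁) (hpos i θ₀)).le]
    have := (hpos i θ₀).ne'
    field_simp
  calc posterior ε κ η s y V
      ≤ ENNReal.ofReal (∏ i, c * marginal ε κ (s i) (y i) θ₁) /
          (ENNReal.ofReal (∏ i, marginal ε κ (s i) (y i) θ₀ / c) * η.measure W) := by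
        rw [posterior_apply η s y hVm]
        refine setLIntegral_div_lintegral_le hVm hWm (fun θ hθ => ?_) fun θ hθ => ?_
        · exact ENNReal.ofReal_le_ofReal (Finset.prod_le_prod (fun i _ => (hpos i θ).le)
            fun i _ => hV θ hθ _ (hs i) _)
        · exact ENNReal.ofReal_le_ofReal (Finset.prod_le_prod
            (fun i _ => (div_pos (hpos i θ₀) hc).le)
            fun i _ => (div_le_iff₀' hc).mpr (hW θ hθ _ (hs i) _))
    _ = (η.measure W)⁻¹ * ENNReal.ofReal
          ((∏ i, c * marginal ε κ (s i) (y i) θ₁) / ∏ i, marginal ε κ (s i) (y i) θ₀ / c) := by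
        rw [ENNReal.ofReal_div_of_pos hlower, ENNReal.div_eq_inv_mul, ENNReal.div_eq_inv_mul,
          ENNReal.mul_inv (.inl (ENNReal.ofReal_pos.mpr hlower).ne') (.inl ENNReal.ofReal_ne_top),
          mul_comm _ (η.measure W)⁻¹, mul_assoc]
    _ = (η.measure W)⁻¹ *
          (∏ i, ENNReal.ofReal c * rootLikelihoodRatio ε κ θ₁ θ₀ (s i) (y i)) ^ 2 := by
        simp_rw [rootLikelihoodRatio, ← ENNReal.ofReal_mul hc.le]
        rw [← Finset.prod_div_distrib, ← Finset.prod_congr rfl fun i _ => hsq i, Finset.prod_pow,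
          ENNReal.ofReal_pow (by positivity),
          ENNReal.ofReal_prod_of_nonneg fun _ _ => by positivity]

lemma le_mul_of_le_mul_sq {p a b : ℝ≥0∞} (hp : p ≤ 1) (ha : 1 ≤ a) (h : p ≤ a * b ^ 2) :
    p ≤ a * b := by
  refine (ENNReal.pow_le_pow_left_iff two_ne_zero).mp ?_
  calc p ^ 2 ≤ p := pow_le_of_le_one zero_le hp two_ne_zero
    _ ≤ a * b ^ 2 := h
    _ ≤ a ^ 2 * b ^ 2 := by gcongr; exact le_self_pow₀ ha two_ne_zero
    _ = (a * b) ^ 2 := (mul_pow a b 2).symm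

lemma exists_posterior_le_mul_prod (ε κ : ℝ) {η : Prior K} {θ₀ : Simplex K}
    (hsupp : θ₀ ∈ η.measure.support) (θ₁ : Simplex K) {c : ℝ} (hc : 1 < c) :
    ∃ V ∈ 𝓝 θ₁, MeasurableSet V ∧ ∃ C ≠ ∞, ∀ (ι : Type) [Fintype ι] (s : ι → Finset (Fin K)),
      (∀ i, s i ≠ Finset.univ) → ∀ y : ι → Fin K, posterior ε κ η s y V ≤
        C * ∏ i, ENNReal.ofReal c * rootLikelihoodRatio ε κ θ₁ θ₀ (s i) (y i) := by
  obtain ⟨V, hV, hVo, hθ₁⟩ := eventually_nhds_iff.mp (eventually_marginal_le_mul θ₁ hc)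
  obtain ⟨W, hW, hWo, hθ₀⟩ := eventually_nhds_iff.mp (eventually_marginal_le_mul θ₀ hc)
  have hWpos : 0 < η.measure W := (Measure.mem_support_iff_forall _).mp hsupp W (hWo.mem_nhds hθ₀)
  refine ⟨V, hVo.mem_nhds hθ₁, hVo.measurableSet, (η.measure W)⁻¹,
    ENNReal.inv_ne_top.mpr hWpos.ne', fun ι _ s hs y => ?_⟩
  have := isProbabilityMeasure_posterior ε κ η s hs y
  exact le_mul_of_le_mul_sq prob_le_one (ENNReal.one_le_inv.mpr prob_le_one)
    (posterior_le_inv_mul_prod_sq η (one_pos.trans hc) hVo.measurableSet hWo.measurableSet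
      (fun θ hθ S hS y => (hV θ hθ S hS y).1) (fun θ hθ S hS y => (hW θ hθ S hS y).2) hs y)

end Posterior

/-! ### Consistency of exact posterior sampling -/

section Run

variable {K : ℕ} {U : Simplex K → Finset (Fin K) → ℝ → ℝ} {ε κ : ℝ}

instance (κ : ℝ) (η : Prior K) (R : SelectionRule U ε) (θ θinit : Simplex K) :
    IsProbabilityMeasure (runLaw κ η R θ θinit) := by
  unfold runLaw
  infer_instance

lemma fst_stepKernel (η : Prior K) (R : SelectionRule U ε) (θ : Simplex K) (n : ℕ) :
    (stepKernel κ η R θ n).fst = samplingKernel κ η R n :=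
  Kernel.fst_compProd _ _

lemma runLaw_parameter_mem (η : Prior K) (R : SelectionRule U ε) (θ θinit : Simplex K) (n : ℕ)
    {V : Set (Simplex K)} (hV : MeasurableSet V) :
    runLaw κ η R θ θinit {w | (w (n + 1)).1 ∈ V} =
      ∫⁻ w, posterior ε κ η (fun i : Finset.Iic n => R.best (w i).1) (fun i => (w i).2) V
        ∂(runLaw κ η R θ θinit) := by
  have hfst : MeasurableSet {x : State K | x.1 ∈ V} := measurable_fst hV
  calc runLaw κ η R θ θinit {w | (w (n + 1)).1 ∈ V}
      = ∫⁻ w, {x : State K | x.1 ∈ V}.indicator 1 (w (n + 1)) ∂(runLaw κ η R θ θinit) :=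
        (lintegral_indicator_one (hfst.preimage (measurable_pi_apply (n + 1)))).symm
    _ = ∫⁻ w, ∫⁻ x, {x : State K | x.1 ∈ V}.indicator 1 x
          ∂(stepKernel κ η R θ n (Preorder.frestrictLe n w)) ∂(runLaw κ η R θ θinit) :=
        lintegral_trajMeasure_succ (X := fun _ => State K)
          (f := fun p => {x : State K | x.1 ∈ V}.indicator 1 p.2)
          ((measurable_one.indicator hfst).comp measurable_snd)
    _ = ∫⁻ w, samplingKernel κ η R n (Preorder.frestrictLe n w) V ∂(runLaw κ η R θ θinit) := by
        simp_rw [lintegral_indicator_one hfst, ← fst_stepKernel η R θ, Kernel.fst_apply' _ _ hV]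
    _ = ∫⁻ w, posterior ε κ η (fun i : Finset.Iic n => R.best (w i).1) (fun i => (w i).2) V
          ∂(runLaw κ η R θ θinit) := rfl

lemma lintegral_prod_runLaw_le (η : Prior K) (R : SelectionRule U ε) (θ θinit : Simplex K)
    {f : State K → ℝ≥0∞} (hf : Measurable f) {r : ℝ≥0∞}
    (hr : ∀ ϑ, ∫⁻ y, f (ϑ, y) ∂(responseKernel κ R θ ϑ) ≤ r) (n : ℕ) :
    ∫⁻ w, ∏ i : Finset.Iic n, f (w i) ∂(runLaw κ η R θ θinit) ≤ r ^ (n + 1) := by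
  refine lintegral_prod_trajMeasure_le (X := fun _ => State K) (f := fun _ => f) (fun _ => hf)
    ?_ (fun m h => ?_) n
  · rw [Measure.lintegral_compProd hf, lintegral_dirac]
    exact hr θinit
  · rw [stepKernel, Kernel.lintegral_compProd _ _ _ hf]
    calc ∫⁻ ϑ, ∫⁻ y, f (ϑ, y) ∂(responseKernel κ R θ ϑ) ∂(samplingKernel κ η R m h)
        ≤ ∫⁻ _, r ∂(samplingKernel κ η R m h) := lintegral_mono hr
      _ = r := by rw [lintegral_const, measure_univ, mul_one]

lemma measurable_rootLikelihoodRatio_best (R : SelectionRule U ε) (θ₁ θ₀ : Simplex K) :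
    Measurable fun x : State K => rootLikelihoodRatio ε κ θ₁ θ₀ (R.best x.1) x.2 := by
  have hpair : Measurable fun x : State K => (R.best x.1, x.2) :=
    (R.measurable_topSet.comp measurable_fst).prodMk measurable_snd
  have hratio : Measurable fun p : Finset (Fin K) × Fin K =>
      rootLikelihoodRatio ε κ θ₁ θ₀ p.1 p.2 := measurable_of_countable _
  simpa only [Function.comp_def] using hratio.comp hpair

lemma lintegral_rootLikelihoodRatio_responseKernel_le (R : SelectionRule U ε) {θ₁ θ₀ : Simplex K}
    {c r : ℝ} (hc : 0 ≤ c) (hr : ∀ S ≠ Finset.univ,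
      affinity (fun y => marginal ε κ S y θ₁) (fun y => marginal ε κ S y θ₀) ≤ r)
    (ϑ : Simplex K) :
    ∫⁻ y, ENNReal.ofReal c * rootLikelihoodRatio ε κ θ₁ θ₀ (R.best ϑ) y
      ∂(responseKernel κ R θ₀ ϑ) ≤ ENNReal.ofReal (c * r) := by
  change ∫⁻ y, _ ∂(responseLaw ε κ θ₀ (R.best ϑ)) ≤ _
  rw [lintegral_const_mul _ (measurable_of_countable _),
    lintegral_rootLikelihoodRatio (R.best_ne_univ ϑ), ENNReal.ofReal_mul hc]
  gcongr
  exact hr _ (R.best_ne_univ ϑ)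

lemma runLaw_parameter_mem_le {η : Prior K} (R : SelectionRule U ε) {θ₁ θ₀ : Simplex K}
    (θinit : Simplex K) {c r : ℝ} (hc : 0 ≤ c) (hr : ∀ S ≠ Finset.univ,
      affinity (fun y => marginal ε κ S y θ₁) (fun y => marginal ε κ S y θ₀) ≤ r)
    {V : Set (Simplex K)} (hV : MeasurableSet V) {C : ℝ≥0∞} (hC : C ≠ ∞)
    (hpost : ∀ (ι : Type) [Fintype ι] (s : ι → Finset (Fin K)), (∀ i, s i ≠ Finset.univ) →
      ∀ y : ι → Fin K, posterior ε κ η s y V ≤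
        C * ∏ i, ENNReal.ofReal c * rootLikelihoodRatio ε κ θ₁ θ₀ (s i) (y i)) (n : ℕ) :
    runLaw κ η R θ₀ θinit {w | (w (n + 1)).1 ∈ V} ≤ C * ENNReal.ofReal (c * r) ^ (n + 1) := by
  rw [runLaw_parameter_mem η R θ₀ θinit n hV]
  calc ∫⁻ w, posterior ε κ η (fun i : Finset.Iic n => R.best (w i).1) (fun i => (w i).2) V
        ∂(runLaw κ η R θ₀ θinit)
      ≤ ∫⁻ w, C * ∏ i : Finset.Iic n, ENNReal.ofReal c *
          rootLikelihoodRatio ε κ θ₁ θ₀ (R.best (w i).1) (w i).2 ∂(runLaw κ η R θ₀ θinit) :=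
        lintegral_mono fun w => hpost _ _ (fun _ => R.best_ne_univ _) _
    _ = C * ∫⁻ w, ∏ i : Finset.Iic n, ENNReal.ofReal c *
          rootLikelihoodRatio ε κ θ₁ θ₀ (R.best (w i).1) (w i).2 ∂(runLaw κ η R θ₀ θinit) :=
        lintegral_const_mul' _ _ hC
    _ ≤ C * ENNReal.ofReal (c * r) ^ (n + 1) := by
        gcongr
        exact lintegral_prod_runLaw_le η R θ₀ θinit
          ((measurable_rootLikelihoodRatio_best R θ₁ θ₀).const_mul _)
          (lintegral_rootLikelihoodRatio_responseKernel_le R hc hr) n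

lemma exists_nhds_tendsto_runLaw_zero (hε : 0 < ε) (hκ₀ : 0 < κ) (hκ₁ : κ < 1) {η : Prior K}
    (R : SelectionRule U ε) {θ₀ : Simplex K} (θinit : Simplex K)
    (hsupp : θ₀ ∈ η.measure.support) {θ₁ : Simplex K} (hne : θ₁ ≠ θ₀) :
    ∃ V ∈ 𝓝 θ₁, Tendsto (fun n => runLaw κ η R θ₀ θinit {w | (w (n + 1)).1 ∈ V}) atTop (𝓝 0) := by
  obtain ⟨r, hr₁, hr⟩ := exists_affinity_marginal_le hε hκ₀ hκ₁ hne
  obtain ⟨c, hc₁, hcr⟩ : ∃ c > 1, c * r < 1 := by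
    have hnear : ∀ᶠ c : ℝ in 𝓝[>] 1, c * r < 1 := nhdsWithin_le_nhds
      ((continuous_mul_const r).continuousAt.eventually_lt continuousAt_const (by rwa [one_mul]))
    exact (eventually_mem_nhdsWithin.and hnear).exists
  obtain ⟨V, hV, hVm, C, hC, hpost⟩ := exists_posterior_le_mul_prod ε κ hsupp θ₁ hc₁
  have hlim : Tendsto (fun n => C * ENNReal.ofReal (c * r) ^ (n + 1)) atTop (𝓝 0) := by
    have hgeom := (tendsto_add_atTop_iff_nat 1).mpr
      (ENNReal.tendsto_pow_atTop_nhds_zero_of_lt_one (ENNReal.ofReal_lt_one.mpr hcr))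
    simpa only [mul_zero] using ENNReal.Tendsto.const_mul hgeom (.inr hC)
  exact ⟨V, hV, tendsto_of_tendsto_of_tendsto_of_le_of_le tendsto_const_nhds hlim
    (fun _ => zero_le)
    (runLaw_parameter_mem_le R θinit (zero_lt_one.trans hc₁).le hr hVm hC hpost)⟩

theorem tendstoInMeasure_parameter (hε : 0 < ε) (hκ₀ : 0 < κ) (hκ₁ : κ < 1) {η : Prior K}
    (R : SelectionRule U ε) {θ₀ : Simplex K} (θinit : Simplex K)
    (hsupp : θ₀ ∈ η.measure.support) :
    TendstoInMeasure (runLaw κ η R θ₀ θinit) (fun n w => (w n).1) atTop fun _ => θ₀ := by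
  refine tendstoInMeasure_const_of_forall_ne fun θ₁ hne => ?_
  obtain ⟨V, hV, hlim⟩ := exists_nhds_tendsto_runLaw_zero hε hκ₀ hκ₁ R θinit hsupp hne
  exact ⟨V, hV, (tendsto_add_atTop_iff_nat 1).mp hlim⟩

lemma measurableSet_selected_eq (R : SelectionRule U ε) (t : ℕ) (S : Finset (Fin K)) :
    MeasurableSet {w : ℕ → State K | selected R t w = S} :=
  (R.measurable_topSet.comp (measurable_fst.comp (measurable_pi_apply (t - 1))))
    (measurableSet_singleton S)

end Run

end AdOBEst

open AdOBEst

theorem mainTheorem2_general {K : ℕ} {ε κ : ℝ} (hε : 0 < ε) (hκ₀ : 0 < κ) (hκ₁ : κ < 1)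
    {U : Simplex K → Finset (Fin K) → ℝ → ℝ} (R : SelectionRule U ε) {η : Prior K}
    {θstar : Simplex K} (θinit : Simplex K) (hsupp : θstar ∈ η.measure.support)
    (horder : StrictAnti fun i => θstar (R.σ θstar i))
    (hcont : ∀ j : Fin K, ContinuousAt (fun θ => U θ (topSet (R.σ θstar) j) ε) θstar)
    (hunique : ∃! k : Fin K, ∀ j : Fin K,
      U θstar (topSet (R.σ θstar) j) ε ≤ U θstar (topSet (R.σ θstar) k) ε) :
    Tendsto (fun n : ℕ => (runLaw κ η R θstar θinit).real {w | selected R n w = R.best θstar})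
      atTop (𝓝 1) ∧
    Tendsto (fun n : ℕ => (1 / (n : ℝ)) * ∑ t ∈ Finset.Icc 1 n,
        ∫ w, Set.indicator {w | selected R t w = R.best θstar} (fun _ => (1 : ℝ)) w
          ∂(runLaw κ η R θstar θinit)) atTop (𝓝 1) := by
  have hmeas (t : ℕ) := measurableSet_selected_eq R t (R.best θstar)
  have hmiss : Tendsto
      (fun n => runLaw κ η R θstar θinit {w | (w n).1 ∉ {θ | R.best θ = R.best θstar}})
      atTop (𝓝 0) :=
    tendsto_measure_notMem_zero_of_tendstoInMeasure_const
      (tendstoInMeasure_parameter hε hκ₀ hκ₁ R θinit hsupp)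
      (R.eventually_best_eq horder hcont hunique)
  have hprob : Tendsto
      (fun n => (runLaw κ η R θstar θinit).real {w | selected R n w = R.best θstar})
      atTop (𝓝 1) :=
    tendsto_measureReal_one_of_compl hmeas (hmiss.comp (tendsto_sub_atTop_nat 1))
  refine ⟨hprob, (tendsto_one_div_mul_sum_Icc hprob).congr fun n => ?_⟩
  congr! 2 with t
  exact (integral_indicator_one (hmeas t)).symm

/-- If the prior condition holds at `θstar`, the components of `θstar` are strictly ordered, the
utility is continuous in the parameter for every proper subset, and the optimal `k` at `θstar` is
unique, then under exact posterior sampling the best subset is selected with probability tending to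
one, hence with expected long-run frequency one. -/
theorem mainTheorem2 {K : ℕ} (ε κ : ℝ) (hε : 0 < ε) (hκ₀ : 0 < κ) (hκ₁ : κ < 1)
    (U : AdOBEst.Simplex K → Finset (Fin K) → ℝ → ℝ)
    (R : AdOBEst.SelectionRule U ε) (η : AdOBEst.Prior K) (θstar θinit : AdOBEst.Simplex K)
    (hprior : AdOBEst.PriorCondition η θstar)
    (horder : StrictAnti fun i => θstar (R.σ θstar i))
    (hcont : ∀ S : Finset (Fin K), S ≠ Finset.univ → Continuous fun θ => U θ S ε)
    (hunique : ∃! k : Fin K, ∀ j : Fin K,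
      U θstar (AdOBEst.topSet (R.σ θstar) j) ε ≤ U θstar (AdOBEst.topSet (R.σ θstar) k) ε) :
    Tendsto (fun n : ℕ => (AdOBEst.runLaw κ η R θstar θinit).real
        {w | AdOBEst.selected R n w = R.best θstar}) atTop (𝓝 1) ∧
    Tendsto (fun n : ℕ => (1 / (n : ℝ)) * ∑ t ∈ Finset.Icc 1 n,
        ∫ w, Set.indicator {w | AdOBEst.selected R t w = R.best θstar} (fun _ => (1 : ℝ)) w
          ∂(AdOBEst.runLaw κ η R θstar θinit)) atTop (𝓝 1) :=
  mainTheorem2_general hε hκ₀ hκ₁ R θinit hprior.mem_support horder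
    (fun _ => (hcont _ (topSet_ne_univ _ _)).continuousAt) hunique

end
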